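/- Let $K$ be a field. A curve over $K$ is a nonsingular, projective, geometrically irreducible one-dimensional variety over $K$, and a cover of curves over $K$ is a nonconstant separable morphism over $K$ between curves over $K$; its degree is the degree of the corresponding extension of function fields. A decomposition of a cover $\phi\colon C\to D$ is an expression $\phi=\phi_n\circ\phi_{n-1}\circ\dots\circ\phi_1$ with $n\ge 1$, where each $\phi_i\colon C_{i-1}\to C_i$ is a cover of curves over $K$ of degree at least $2$ (so $C_0=C$ and $C_n=D$). Two decompositions $\phi=\phi_n\circ\dots\circ\phi_1=\psi_m\circ\dots\circ\psi_1$, with $\phi_i\colon C_{i-1}\to C_i$ and $\psi_i\colon B_{i-1}\to B_i$, are equivalent if $m=n$ and there are isomorphisms $\rho_i\colon C_i\to B_i$ over $K$ for $0\le i\le n$ such that $\rho_0$ and $\rho_n$ are the identity maps of $C$ and $D$ and $\psi_i\circ\rho_{i-1}=\rho_i\circ\phi_i$ for $1\le i\le n$. **Corollary 2.3.** Every cover $\phi$ of curves over any field $K$ has only finitely many equivalence classes of decompositions. Moreover, the number of these equivalence classes is bounded above by a constant which depends only on the degree $d$ of $\phi$, namely by the number of strictly decreasing chains $G_0>G_1>\dots>G_m$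 ($m\ge 0$) of subgroups of the symmetric group $S_d$. -/

import Mathlib

open CategoryTheory AlgebraicGeometry

universe u

noncomputable section

/-- Projective `n`-space over a field `K`, i.e. `Proj K[x₀, …, xₙ]` with the standard grading,
together with its structure morphism to `Spec K`. -/
def projectiveSpace (K : Type u) [Field K] (n : ℕ) : Over (Spec (CommRingCat.of K)) :=
  letI : GradedAlgebra (MvPolynomial.homogeneousSubmodule (Fin (n + 1)) K) :=
    MvPolynomial.gradedAlgebra
  Over.mk (Proj.toSpecZero (MvPolynomial.homogeneousSubmodule (Fin (n + 1)) K) ≫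
    Spec.map (CommRingCat.ofHom
      (algebraMap K (MvPolynomial.homogeneousSubmodule (Fin (n + 1)) K 0))))

/-- The `K`-scheme `X` is a curve over `K`: a nonsingular, projective, geometrically irreducible
one-dimensional variety over `K`. -/
structure IsCurve (K : Type u) [Field K] (X : Over (Spec (CommRingCat.of K))) : Prop where
  isIntegral : IsIntegral X.left
  geometricallyIrreducible : GeometricallyIrreducible X.hom
  /-- `X` is isomorphic over `K` to a closed subscheme of some projective space. -/
  projective : ∃ (n : ℕ) (i : X ⟶ projectiveSpace K n), IsClosedImmersion i.left
  /-- `X` is nonsingular: all its local rings are regular. -/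
  nonsingular : ∀ x : X.left, IsRegularLocalRing (X.left.presheaf.stalk x)
  oneDimensional : topologicalKrullDim X.left = 1

/-- The category of curves over `K`; its morphisms are all the morphisms of `K`-schemes. -/
abbrev Curve (K : Type u) [Field K] : Type (u + 1) :=
  ObjectProperty.FullSubcategory (C := Over (Spec (CommRingCat.of K))) (IsCurve K)

namespace Curve

variable {K : Type u} [Field K]

/-- The underlying scheme of a curve. -/
abbrev scheme (C : Curve K) : Scheme.{u} := C.obj.left

instance (C : Curve K) : IsIntegral C.scheme := C.property.isIntegral

/-- The morphism of schemes underlying a morphism of curves. -/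
abbrev schemeHom {C D : Curve K} (φ : C ⟶ D) : C.scheme ⟶ D.scheme := φ.hom.left

/-- The pullback of functions `K(D) → K(C)` along a nonconstant morphism `φ : C ⟶ D`: the map that
`φ` induces on local rings at the generic point `η` of `C`. A nonconstant `φ` sends `η` to the
generic point of `D`, so that the local ring of `D` at `φ(η)` is the function field `K(D)`. -/
def functionFieldMap {C D : Curve K} (φ : C ⟶ D) :
    D.scheme.presheaf.stalk (schemeHom φ (genericPoint C.scheme)) →+*
      C.scheme.presheaf.stalk (genericPoint C.scheme) :=
  ((schemeHom φ).stalkMap (genericPoint C.scheme)).hom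

/-- `φ` is constant: its image is a single (closed) point. -/
def IsConstant {C D : Curve K} (φ : C ⟶ D) : Prop :=
  ∃ d : D.scheme, ∀ c : C.scheme, schemeHom φ c = d

/-- The extension of function fields `K(C)/K(D)` given by `φ` is separable. -/
def IsSeparableHom {C D : Curve K} (φ : C ⟶ D) : Prop :=
  letI := (functionFieldMap φ).toAlgebra
  Algebra.IsSeparable (D.scheme.presheaf.stalk (schemeHom φ (genericPoint C.scheme)))
    (C.scheme.presheaf.stalk (genericPoint C.scheme))

/-- A cover of curves over `K`: a nonconstant separable morphism between curves over `K`. -/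
structure IsCover {C D : Curve K} (φ : C ⟶ D) : Prop where
  nonconstant : ¬ IsConstant φ
  separable : IsSeparableHom φ

/-- The degree `[K(C) : K(D)]` of a nonconstant morphism `φ : C ⟶ D`. -/
def degree {C D : Curve K} (φ : C ⟶ D) : ℕ :=
  letI := (functionFieldMap φ).toAlgebra
  Module.finrank (D.scheme.presheaf.stalk (schemeHom φ (genericPoint C.scheme)))
    (C.scheme.presheaf.stalk (genericPoint C.scheme))

/-- Every arrow `φᵢ` of the path `C = C₀ ⟶ C₁ ⟶ ⋯ ⟶ Cₙ = D` is a cover of degree at least `2`. -/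
def AllCovers {C : Curve K} : ∀ {D : Curve K}, Quiver.Path C D → Prop
  | _, .nil => True
  | _, .cons p φ => AllCovers p ∧ IsCover φ ∧ 2 ≤ degree φ

/-- A decomposition of `φ : C ⟶ D`: a sequence `C = C₀ ⟶ C₁ ⟶ ⋯ ⟶ Cₙ = D`, with `n ≥ 1`, of
covers of curves over `K` of degree at least `2` whose composition is `φ`. -/
structure Decomposition {C D : Curve K} (φ : C ⟶ D) where
  path : Quiver.Path C D
  length_pos : 1 ≤ path.length
  allCovers : AllCovers path
  composition : composePath path = φ

/-- `PathIso p q ρ`: the paths `p = (C = C₀ ⟶ C₁ ⟶ ⋯ ⟶ Cₙ)`, with arrows `φᵢ : Cᵢ₋₁ ⟶ Cᵢ`, and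
`q = (C = B₀ ⟶ B₁ ⟶ ⋯ ⟶ Bₙ)`, with arrows `ψᵢ : Bᵢ₋₁ ⟶ Bᵢ`, have the same length `n`, and there
are isomorphisms `ρᵢ : Cᵢ ≅ Bᵢ` over `K` for `0 ≤ i ≤ n`, with `ρ₀` the identity and `ρₙ = ρ`, such
that `ψᵢ ∘ ρᵢ₋₁ = ρᵢ ∘ φᵢ` for `1 ≤ i ≤ n`. -/
inductive PathIso {C : Curve K} :
    ∀ {E F : Curve K}, Quiver.Path C E → Quiver.Path C F → (E ≅ F) → Prop
  | nil : PathIso Quiver.Path.nil Quiver.Path.nil (Iso.refl C)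
  | cons {E F E' F' : Curve K} {p : Quiver.Path C E} {q : Quiver.Path C F} {ρ : E ≅ F}
      (h : PathIso p q ρ) (φ : E ⟶ E') (ψ : F ⟶ F') (ρ' : E' ≅ F')
      (comm : ρ.hom ≫ ψ = φ ≫ ρ'.hom) : PathIso (p.cons φ) (q.cons ψ) ρ'

lemma PathIso.rfl {C : Curve K} : ∀ {E : Curve K} (p : Quiver.Path C E),
    PathIso p p (Iso.refl E)
  | _, .nil => .nil
  | _, .cons p φ => .cons (PathIso.rfl p) φ φ _ (by simp)

lemma PathIso.symm {C E F : Curve K} {p : Quiver.Path C E} {q : Quiver.Path C F} {ρ : E ≅ F}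
    (h : PathIso p q ρ) : PathIso q p ρ.symm := by
  induction h with
  | nil => exact .nil
  | cons h φ ψ ρ' comm ih =>
    refine .cons ih ψ φ _ ?_
    rw [Iso.symm_hom, Iso.symm_hom, Iso.inv_comp_eq, ← Category.assoc, comm, Category.assoc,
      Iso.hom_inv_id, Category.comp_id]

lemma PathIso.trans {C E F G : Curve K} {p : Quiver.Path C E} {q : Quiver.Path C F}
    {r : Quiver.Path C G} {ρ : E ≅ F} {σ : F ≅ G}
    (h : PathIso p q ρ) (h' : PathIso q r σ) : PathIso p r (ρ ≪≫ σ) := by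
  induction h generalizing G with
  | nil => simpa using h'
  | cons h φ ψ ρ' comm ih =>
    cases h' with
    | cons h₂ _ χ σ' comm₂ =>
      refine .cons (ih h₂) φ χ _ ?_
      simp [comm₂, reassoc_of% comm]

/-- Two decompositions `φ = φₙ ∘ ⋯ ∘ φ₁ = ψₘ ∘ ⋯ ∘ ψ₁` of `φ : C ⟶ D` are equivalent if `m = n` and
there are isomorphisms `ρᵢ : Cᵢ ≅ Bᵢ` with `ρ₀` and `ρₙ` the identities of `C` and `D` such that
`ψᵢ ∘ ρᵢ₋₁ = ρᵢ ∘ φᵢ` for `1 ≤ i ≤ n`. -/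
def Decomposition.setoid {C D : Curve K} (φ : C ⟶ D) : Setoid (Decomposition φ) where
  r p q := PathIso p.path q.path (Iso.refl D)
  iseqv :=
    { refl := fun p => PathIso.rfl p.path
      symm := fun h => h.symm
      trans := fun h h' => by simpa using h.trans h' }

/-- The equivalence classes of decompositions of `φ`. -/
abbrev DecompositionClass {C D : Curve K} (φ : C ⟶ D) : Type (u + 1) :=
  Quotient (Decomposition.setoid φ)

end Curve

/-- The number of (strictly) decreasing chains `G₀ > G₁ > ⋯ > Gₘ`, `m ≥ 0`, of subgroups of the
symmetric group `Sₙ`. -/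
def decreasingChainCount (n : ℕ) : ℕ :=
  Nat.card (LTSeries (Subgroup (Equiv.Perm (Fin n)))ᵒᵈ)

end

/-! A decomposition of `φ : C ⟶ D` is the same, up to equivalence, as its strict chain of subfields
of `K(C)` above the image of `K(D)`, namely the pullbacks of the function fields of the `Cᵢ`. The
chain is strict because each step has degree at least 2 (`pullbackRange_comp_lt`). It determines the
decomposition because two curves with the same pullback in `K(C)` are isomorphic under `C`
(`exists_iso_of_range_eq`): local rings of curves are valuation rings and curves are proper, so maps
at the generic point extend by the valuative criterion (`exists_hom_of_functionField`).

Galois theory then bounds the chains. For `E/F` finite separable of degree `d` and `L` a separable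
closure, the automorphism group of `L/F` permutes the `d` embeddings `E → L`. Sending an
intermediate field to the image in `S_d` of its fixer reverses inclusions and is injective
(`subringPerm_injOn`), so chains of fields inject into decreasing chains of subgroups of `S_d`. -/

noncomputable section

/-! ### Intermediate fields and permutations of embeddings. -/

section GaloisAction

variable (F E L : Type*) [Field F] [Field E] [Field L] [Algebra F E] [Algebra F L]

/-- The permutation of the set of `F`-embeddings `E → L` given by composition with an
automorphism of `L`. -/
def embeddingPerm : (L ≃ₐ[F] L) →* Equiv.Perm (E →ₐ[F] L) where
  toFun σ :=
    { toFun f := σ.toAlgHom.comp f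
      invFun f := σ.symm.toAlgHom.comp f
      left_inv f := by ext; simp
      right_inv f := by ext; simp }
  map_one' := by ext; simp
  map_mul' σ τ := by ext; simp

variable {F E L}

lemma embeddingPerm_apply (σ : L ≃ₐ[F] L) (f : E →ₐ[F] L) (x : E) :
    embeddingPerm F E L σ f x = σ (f x) := rfl

/-- The automorphisms of `L` that are trivial on the image of a subring of `E`. -/
def subringFixer (f : E →ₐ[F] L) (S : Subring E) : Subgroup (L ≃ₐ[F] L) where
  carrier := {σ | ∀ x ∈ S, σ (f x) = f x}
  one_mem' := by simp
  mul_mem' {σ τ} hσ hτ x hx := by rw [AlgEquiv.mul_apply, hτ x hx, hσ x hx]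
  inv_mem' {σ} hσ x hx := by
    rw [← hσ x hx, ← AlgEquiv.mul_apply, inv_mul_cancel, AlgEquiv.one_apply, hσ x hx]

lemma mem_of_forall_mem_subringFixer [Algebra.IsAlgebraic F E] [IsGalois F L] (f : E →ₐ[F] L)
    {S : Subring E} (hS : (algebraMap F E).range ≤ S) {x : E}
    (hx : ∀ σ ∈ subringFixer f S, σ (f x) = f x) : x ∈ S := by
  let A : Subalgebra F E := { S with algebraMap_mem' := fun r => hS ⟨r, rfl⟩ }
  -- A subring between `F` and an algebraic extension is a field, so the Galois correspondence
  -- applies to it.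
  have : Algebra.IsAlgebraic F A := Algebra.IsAlgebraic.of_injective A.val Subtype.val_injective
  let M : IntermediateField F L := (Algebra.IsAlgebraic.toIntermediateField A).map f
  have h : f x ∈ IntermediateField.fixedField M.fixingSubgroup := by
    rintro ⟨σ, hσ⟩
    refine hx σ fun y hy => ?_
    exact hσ ⟨f y, (⟨y, hy, rfl⟩ : ∃ z ∈ S, f z = f y)⟩
  rw [InfiniteGalois.fixedField_fixingSubgroup] at h
  obtain ⟨y, hy, hyx⟩ : ∃ y ∈ S, f y = f x := h
  rw [← f.injective hyx]
  exact hy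

/-- The subgroups of `Perm (E →ₐ[F] L)` attached to the subrings of `E`. -/
def subringPerm (f : E →ₐ[F] L) (S : Subring E) : Subgroup (Equiv.Perm (E →ₐ[F] L)) :=
  (subringFixer f S).map (embeddingPerm F E L)

lemma subringPerm_antitone (f : E →ₐ[F] L) : Antitone (subringPerm f) := fun _ _ h =>
  Subgroup.map_mono fun _ hσ x hx => hσ x (h hx)

/-- Passing to permutations loses nothing: the permutation of `σ` determines `σ ∘ f`, hence whether
`σ` fixes a given element of `f(E)`. -/
lemma subringPerm_injOn [Algebra.IsAlgebraic F E] [IsGalois F L] (f : E →ₐ[F] L) :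
    Set.InjOn (subringPerm f) {S | (algebraMap F E).range ≤ S} := by
  have key : ∀ S T : Subring E, (algebraMap F E).range ≤ S → subringPerm f S = subringPerm f T →
      T ≤ S := by
    intro S T hS h x hx
    refine mem_of_forall_mem_subringFixer f hS fun σ hσ => ?_
    obtain ⟨τ, hτ, hτσ⟩ : embeddingPerm F E L σ ∈ subringPerm f T :=
      h ▸ Subgroup.mem_map_of_mem _ hσ
    rw [← embeddingPerm_apply, ← hτσ, embeddingPerm_apply, hτ x hx]
  exact fun S hS T hT h => le_antisymm (key T S hT h.symm) (key S T hS h)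

end GaloisAction

lemma exists_subgroup_perm_of_subring (F : Type*) {E : Type*} [Field F] [Field E] [Algebra F E]
    [FiniteDimensional F E] [Algebra.IsSeparable F E] :
    ∃ G : Subring E → Subgroup (Equiv.Perm (Fin (Module.finrank F E))), Antitone G ∧
      Set.InjOn G {S | (algebraMap F E).range ≤ S} := by
  let L := SeparableClosure E
  have : Algebra.IsSeparable F L := Algebra.IsSeparable.trans F E L
  have : IsSepClosure F L := ⟨inferInstance, inferInstance⟩
  have : IsGalois F L := IsSepClosure.isGalois
  have hcard : Fintype.card (E →ₐ[F] L) = Module.finrank F E :=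
    AlgHom.card_of_splits F E L fun x =>
      IsSepClosed.splits_of_separable _ (Polynomial.Separable.map (Algebra.IsSeparable.isSeparable F x))
  let e : Equiv.Perm (E →ₐ[F] L) ≃* Equiv.Perm (Fin (Module.finrank F E)) :=
    (Fintype.equivFinOfCardEq hcard).permCongrHom
  let f : E →ₐ[F] L := IsScalarTower.toAlgHom F E L
  refine ⟨fun S => (subringPerm f S).map e.toMonoidHom,
    fun S T h => Subgroup.map_mono (subringPerm_antitone f h), fun S hS T hT h => ?_⟩
  exact subringPerm_injOn f hS hT (Subgroup.map_injective e.injective h)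

lemma Set.InjOn.list_map_eq {α β : Type*} {f : α → β} {s : Set α} (hf : s.InjOn f) :
    ∀ {l l' : List α}, (∀ a ∈ l, a ∈ s) → (∀ a ∈ l', a ∈ s) → l.map f = l'.map f → l = l'
  | [], [], _, _, _ => rfl
  | a :: l, b :: l', hl, hl', h => by
    simp only [List.map_cons, List.cons.injEq] at h
    rw [hf (hl a (by simp)) (hl' b (by simp)) h.1,
      list_map_eq hf (fun a ha => hl a (by simp [ha])) (fun a ha => hl' a (by simp [ha])) h.2]

/-- Strict chains of subrings that contain a subfield with finite separable extension inject into
decreasing chains of subgroups of the symmetric group. -/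
lemma finite_and_card_le_of_injective_chains {F E : Type*} [Field F] [Field E] [Algebra F E]
    [FiniteDimensional F E] [Algebra.IsSeparable F E] {α : Type*} (c : α → List (Subring E))
    (hinj : Function.Injective c) (hne : ∀ a, c a ≠ []) (hlt : ∀ a, (c a).IsChain (· < ·))
    (hle : ∀ a, ∀ S ∈ c a, (algebraMap F E).range ≤ S) :
    Finite α ∧ Nat.card α ≤ decreasingChainCount (Module.finrank F E) := by
  obtain ⟨G, hG, hGinj⟩ := exists_subgroup_perm_of_subring F (E := E)
  have hchain (a : α) : ((c a).map fun S => OrderDual.toDual (G S)).IsChain (· < ·) := by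
    refine (List.isChain_map _).2 ?_
    refine List.IsChain.imp_of_mem_imp ?_ (hlt a)
    intro S T hS hT hST
    exact lt_of_le_of_ne (hG hST.le) fun h => hST.ne (hGinj (hle a S hS) (hle a T hT) h)
  -- Lists run from smaller to larger subrings, so their groups decrease, which is an increasing
  -- series in the order dual.
  let g (a : α) : LTSeries (Subgroup (Equiv.Perm (Fin (Module.finrank F E))))ᵒᵈ :=
    RelSeries.fromListIsChain ((c a).map fun S => OrderDual.toDual (G S))
      (by simpa using hne a) (hchain a)
  have hg : Function.Injective g := by
    intro a b hab
    have h := congrArg RelSeries.toList hab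
    simp only [g, RelSeries.toList_fromListIsChain] at h
    exact hinj (hGinj.list_map_eq (hle a) (hle b) h)
  classical
  have : Finite (LTSeries (Subgroup (Equiv.Perm (Fin (Module.finrank F E))))ᵒᵈ) := inferInstance
  exact ⟨.of_injective g hg, Nat.card_le_card_of_injective g hg⟩

/-! ### Properness, local rings and points of curves. -/

lemma isProper_projectiveSpace (K : Type u) [Field K] (n : ℕ) :
    IsProper (projectiveSpace K n).hom := by
  let : GradedAlgebra (MvPolynomial.homogeneousSubmodule (Fin (n + 1)) K) :=
    MvPolynomial.gradedAlgebra
  let A := MvPolynomial.homogeneousSubmodule (Fin (n + 1)) K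
  have hcoe (c : K) : (algebraMap K (A 0) c : MvPolynomial (Fin (n + 1)) K) = MvPolynomial.C c :=
    rfl
  -- Homogeneous polynomials of degree zero are constants, so the base of `Proj` is `Spec K` itself.
  have hbij : Function.Bijective (algebraMap K (A 0)) := by
    refine ⟨fun a b h => ?_, fun ⟨p, hp⟩ => ?_⟩
    · have := congrArg Subtype.val h
      rwa [hcoe, hcoe, MvPolynomial.C_inj] at this
    · refine ⟨p.coeff 0, Subtype.ext ?_⟩
      rw [hcoe]
      exact (MvPolynomial.totalDegree_eq_zero_iff_eq_C.1
        (Nat.le_zero.1 (MvPolynomial.IsHomogeneous.totalDegree_le hp))).symm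
  have : IsIso (CommRingCat.ofHom (algebraMap K (A 0))) :=
    (ConcreteCategory.isIso_iff_bijective _).2 hbij
  have : IsScalarTower K (A 0) (MvPolynomial (Fin (n + 1)) K) :=
    ⟨fun a b c => smul_mul_assoc a (b : MvPolynomial (Fin (n + 1)) K) c⟩
  have : Algebra.FiniteType (A 0) (MvPolynomial (Fin (n + 1)) K) :=
    Algebra.FiniteType.of_restrictScalars_finiteType K _ _
  change IsProper (Proj.toSpecZero A ≫ Spec.map (CommRingCat.ofHom (algebraMap K (A 0))))
  infer_instance

namespace Curve

variable {K : Type u} [Field K]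

instance isProper_hom (C : Curve K) : IsProper C.obj.hom := by
  obtain ⟨n, i, hi⟩ := C.property.projective
  have := isProper_projectiveSpace K n
  rw [← Over.w i]
  infer_instance

instance isSeparated_scheme (C : Curve K) : C.scheme.IsSeparated :=
  ⟨by rw [← Limits.terminal.comp_from C.obj.hom]; infer_instance⟩

instance (C : Curve K) (x : C.scheme) : IsRegularLocalRing (C.scheme.presheaf.stalk x) :=
  C.property.nonsingular x

lemma coheight_le_one (C : Curve K) (x : C.scheme) : Order.coheight x ≤ 1 := by
  let f : C.scheme → TopologicalSpace.IrreducibleCloseds C.scheme := fun x =>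
    { carrier := closure {x}
      isIrreducible' := isIrreducible_singleton.closure
      isClosed' := isClosed_closure }
  have hf : StrictMono f := by
    have hle (x y : C.scheme) : x ≤ y ↔ f x ≤ f y :=
      (specializes_iff_closure_subset (x := y) (y := x))
    exact fun x y h => lt_of_le_not_ge ((hle x y).1 h.le) fun h' => h.not_ge ((hle y x).2 h')
  have h := (Order.coheight_le_krullDim x).trans (Order.krullDim_le_of_strictMono f hf)
  have h1 := C.property.oneDimensional
  rw [topologicalKrullDim] at h1
  rw [h1] at h
  exact_mod_cast h

/-- Regularity makes the number of generators of the maximal ideal equal to the dimension, which is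
at most 1. A principal maximal ideal gives a valuation ring; the case of zero generators is the
generic point. -/
instance valuationRing_stalk (C : Curve K) (x : C.scheme) :
    ValuationRing (C.scheme.presheaf.stalk x) := by
  refine ((tfae_of_isNoetherianRing_of_isLocalRing_of_isDomain _).out 4 1).1 ?_
  have h := IsRegularLocalRing.spanFinrank_maximalIdeal (R := C.scheme.presheaf.stalk x)
  rw [ringKrullDim_stalk_eq_coheight] at h
  have h1 : (IsLocalRing.maximalIdeal (C.scheme.presheaf.stalk x)).spanFinrank ≤ 1 := by
    have := C.coheight_le_one x
    have h2 : ((IsLocalRing.maximalIdeal (C.scheme.presheaf.stalk x)).spanFinrank : ℕ∞) =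
      Order.coheight x := by exact_mod_cast h
    rw [← h2] at this
    exact_mod_cast this
  obtain h0 | h0 := Nat.le_one_iff_eq_zero_or_eq_one.1 h1
  · rw [(Submodule.spanFinrank_eq_zero_iff_eq_bot (IsNoetherian.noetherian _)).1 h0]
    infer_instance
  · exact ((Submodule.spanFinrank_eq_one_iff _).1 h0).1

lemma eq_genericPoint_or_isClosed (C : Curve K) (x : C.scheme) :
    x = genericPoint C.scheme ∨ IsClosed {x} := by
  by_contra! h
  obtain ⟨h1, h2⟩ := h
  obtain ⟨y, hy, hyx⟩ : ∃ y ∈ closure {x}, y ≠ x := by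
    by_contra! h
    exact h2 (closure_subset_iff_isClosed.1 h)
  have hlt {a b : C.scheme} (h : b ⤳ a) (hne : a ≠ b) : a < b :=
    lt_of_le_not_ge h fun h' => hne (Specializes.antisymm (show a ⤳ b from h') h).eq
  have hx1 := Order.coheight_add_one_le (hlt (specializes_iff_mem_closure.2 hy) hyx)
  have hx2 := Order.coheight_add_one_le (hlt (genericPoint_specializes x) h1)
  -- A point neither generic nor closed would lie strictly inside a chain of three points,
  -- contradicting dimension one.
  have h3 : Order.coheight (genericPoint C.scheme) + 1 + 1 ≤ 1 :=
    (by gcongr : _ ≤ _).trans (hx1.trans (C.coheight_le_one y))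
  generalize Order.coheight (genericPoint C.scheme) = n at h3
  induction n using ENat.recTopCoe with
  | top => simp at h3
  | coe n => norm_cast at h3

/-- If the generic point went to a closed point, all its specializations would go there too. -/
lemma isDominant_schemeHom {C D : Curve K} {φ : C ⟶ D} (hφ : ¬ IsConstant φ) :
    IsDominant (schemeHom φ) := by
  have hd := (D.eq_genericPoint_or_isClosed (schemeHom φ (genericPoint C.scheme))).resolve_right
    fun h => hφ ⟨_, fun c => h.closure_eq ▸
      ((genericPoint_specializes c).map (schemeHom φ).continuous).mem_closure⟩
  refine ⟨fun y => ?_⟩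
  refine closure_mono (Set.singleton_subset_iff.2 (Set.mem_range_self (genericPoint C.scheme))) ?_
  rw [hd]
  exact (genericPoint_specializes y).mem_closure

lemma apply_genericPoint {C D : Curve K} (φ : C ⟶ D) [IsDominant (schemeHom φ)] :
    schemeHom φ (genericPoint C.scheme) = genericPoint D.scheme :=
  ((genericPoint_spec C.scheme).image (schemeHom φ).continuous).eq <| by
    rw [Set.image_univ, (schemeHom φ).denseRange.closure_eq]
    exact genericPoint_spec D.scheme

end Curve

/-! ### Extending morphisms from the generic point. -/

section Extension

variable {S X Y : Scheme.{u}} (sX : X ⟶ S) (sY : Y ⟶ S) [IsIntegral X]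

lemma fromSpecStalk_lift_of_valuationRing [IsProper sY] (x : X)
    [ValuationRing (X.presheaf.stalk x)] (h : Spec X.functionField ⟶ Y)
    (hs : h ≫ sY = X.fromSpecStalk _ ≫ sX) :
    ∃ l : Spec (X.presheaf.stalk x) ⟶ Y, l ≫ sY = X.fromSpecStalk x ≫ sX ∧
      Spec.map (X.presheaf.stalkSpecializes (genericPoint_specializes x)) ≫ l = h := by
  have hp : ValuativeCriterion sY := by
    have h := IsProper.eq_valuativeCriterion ▸ (inferInstance : IsProper sY)
    exact h.1.1.1
  let e : ValuativeCommSq sY :=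
    { R := X.presheaf.stalk x
      commRing := (X.presheaf.stalk x).commRing
      domain := (inferInstance : IsDomain (X.presheaf.stalk x))
      valuationRing := (inferInstance : ValuationRing (X.presheaf.stalk x))
      K := X.functionField
      field := (inferInstance : Field X.functionField)
      algebra := (inferInstance : Algebra (X.presheaf.stalk x) X.functionField)
      isFractionRing := (inferInstance : IsFractionRing (X.presheaf.stalk x) X.functionField)
      i₁ := h
      i₂ := X.fromSpecStalk x ≫ sX
      commSq := ⟨by
        exact hs.trans (Scheme.SpecMap_stalkSpecializes_fromSpecStalk_assoc
          (genericPoint_specializes x) sX).symm⟩ }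
  obtain ⟨⟨l⟩⟩ := hp.existence e
  exact ⟨l.l, l.fac_right, l.fac_left⟩

instance isDominant_fromSpecStalk_genericPoint :
    IsDominant (X.fromSpecStalk (genericPoint X)) := by
  refine ⟨fun y => ?_⟩
  refine closure_mono (Set.singleton_subset_iff.2 ?_) (genericPoint_specializes y).mem_closure
  rw [Scheme.range_fromSpecStalk]
  exact specializes_rfl

lemma exists_hom_of_domain_eq_top (g : X.PartialMap Y) (hg : g.domain = ⊤) :
    ∃ f : X ⟶ Y, X.fromSpecStalk (genericPoint X) ≫ f = g.fromFunctionField := by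
  obtain ⟨U, hU, g⟩ := g
  obtain rfl : U = ⊤ := hg
  refine ⟨X.topIso.inv ≫ g, ?_⟩
  simp only [Scheme.PartialMap.fromFunctionField, Scheme.PartialMap.fromSpecStalkOfMem,
    ← Category.assoc]
  congr 1
  rw [← cancel_mono (⊤ : X.Opens).ι]
  simp

lemma exists_hom_of_functionField [S.IsSeparated] [IsProper sY] [Y.IsSeparated]
    [∀ x : X, ValuationRing (X.presheaf.stalk x)] (h : Spec X.functionField ⟶ Y)
    (hs : h ≫ sY = X.fromSpecStalk _ ≫ sX) :
    ∃ f : X ⟶ Y, X.fromSpecStalk (genericPoint X) ≫ f = h ∧ f ≫ sY = sX := by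
  let r : X ⤏ Y := Scheme.RationalMap.ofFunctionField sX sY h hs
  have hr : r.fromFunctionField = h :=
    Scheme.RationalMap.fromFunctionField_ofFunctionField sX sY h hs
  have hdom : r.domain = ⊤ := by
    refine top_le_iff.1 fun x _ => ?_
    -- The lift to the local ring at `x` spreads out to a neighbourhood of `x`; it agrees with `r`
    -- generically, so it represents the same rational map.
    obtain ⟨l, hl, hlh⟩ := fromSpecStalk_lift_of_valuationRing sX sY x h hs
    let g := Scheme.PartialMap.ofFromSpecStalk sX sY l hl
    have hxg : x ∈ g.domain := Scheme.PartialMap.mem_domain_ofFromSpecStalk sX sY l hl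
    have hg : g.fromSpecStalkOfMem hxg = l :=
      Scheme.PartialMap.fromSpecStalkOfMem_ofFromSpecStalk sX sY l hl
    refine Scheme.RationalMap.mem_domain.2 ⟨g, hxg, ?_⟩
    refine Scheme.RationalMap.eq_of_fromFunctionField_eq _ _ ?_
    rw [hr, Scheme.RationalMap.fromFunctionField_toRationalMap, ← hlh, ← hg]
    simp only [Scheme.PartialMap.fromFunctionField, Scheme.PartialMap.fromSpecStalkOfMem,
      ← Category.assoc]
    congr 1
    rw [← cancel_mono g.domain.ι]
    simp
  obtain ⟨f, hf⟩ := exists_hom_of_domain_eq_top r.toPartialMap hdom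
  rw [← Scheme.RationalMap.fromFunctionField_toRationalMap,
    Scheme.RationalMap.toRationalMap_toPartialMap, hr] at hf
  refine ⟨f, hf, ext_of_isDominant (X.fromSpecStalk (genericPoint X)) ?_⟩
  rw [← Category.assoc, hf, hs]

end Extension

/-! ### Curves under `C` and subfields of `K(C)`. -/

namespace Curve

variable {K : Type u} [Field K]

lemma isField_stalk_of_isDominant {C D : Curve K} (φ : C ⟶ D) [IsDominant (schemeHom φ)] :
    IsField (D.scheme.presheaf.stalk (schemeHom φ (genericPoint C.scheme))) := by
  rw [apply_genericPoint]
  exact Field.toIsField D.scheme.functionField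

lemma functionFieldMap_injective {C D : Curve K} (φ : C ⟶ D) [IsDominant (schemeHom φ)] :
    Function.Injective (functionFieldMap φ) := by
  let := (isField_stalk_of_isDominant φ).toField
  exact (functionFieldMap φ).injective

lemma exists_ringEquiv_of_range_eq {A B L : Type*} [CommRing A] [CommRing B] [CommRing L]
    {f : A →+* L} {g : B →+* L} (hf : Function.Injective f) (hg : Function.Injective g)
    (h : g.range = f.range) : ∃ e : B ≃+* A, ∀ b, f (e b) = g b := by
  have hf' : Function.Bijective f.rangeRestrict :=
    ⟨fun a b h => hf (congrArg Subtype.val h), f.rangeRestrict_surjective⟩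
  have hg' : Function.Bijective g.rangeRestrict :=
    ⟨fun a b h => hg (congrArg Subtype.val h), g.rangeRestrict_surjective⟩
  refine ⟨((RingEquiv.ofBijective _ hg').trans (RingEquiv.subringCongr h)).trans
    (RingEquiv.ofBijective _ hf').symm, fun b => ?_⟩
  exact congrArg Subtype.val (RingEquiv.apply_symm_apply (RingEquiv.ofBijective _ hf')
    (RingEquiv.subringCongr h (g.rangeRestrict b)))

/-- Dominant morphisms of curves are epimorphisms. -/
lemma cancel_dominant {C D E : Curve K} (φ : C ⟶ D) [IsDominant (schemeHom φ)] {f g : D ⟶ E}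
    (h : φ ≫ f = φ ≫ g) : f = g := by
  ext1
  ext1
  refine ext_of_isDominant (schemeHom φ) ?_
  exact congrArg schemeHom h

instance {C D E : Curve K} (φ : C ⟶ D) (ψ : D ⟶ E) [IsDominant (schemeHom φ)]
    [IsDominant (schemeHom ψ)] : IsDominant (schemeHom (φ ≫ ψ)) :=
  inferInstanceAs (IsDominant (schemeHom φ ≫ schemeHom ψ))

/-- The point is a variable so that this applies at the image of a generic point, which is generic
only up to a propositional equality. -/
lemma exists_hom_of_stalk {E F : Curve K} {x : E.scheme} (hx : x = genericPoint E.scheme)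
    (h : Spec (E.scheme.presheaf.stalk x) ⟶ F.scheme)
    (hs : h ≫ F.obj.hom = E.scheme.fromSpecStalk x ≫ E.obj.hom) :
    ∃ ρ : E ⟶ F, E.scheme.fromSpecStalk x ≫ schemeHom ρ = h := by
  subst hx
  obtain ⟨f, hf, hf'⟩ := exists_hom_of_functionField E.obj.hom F.obj.hom h hs
  exact ⟨ObjectProperty.homMk (Over.homMk f hf'), hf⟩

lemma exists_hom_of_range_eq {C E F : Curve K} (f : C ⟶ E) (g : C ⟶ F)
    [IsDominant (schemeHom f)] [IsDominant (schemeHom g)]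
    (h : (functionFieldMap f).range = (functionFieldMap g).range) : ∃ ρ : E ⟶ F, f ≫ ρ = g := by
  obtain ⟨e, he⟩ := exists_ringEquiv_of_range_eq (functionFieldMap_injective f)
    (functionFieldMap_injective g) h.symm
  let θ := CommRingCat.ofHom e.toRingHom
  let η := genericPoint C.scheme
  have hθ : θ ≫ (schemeHom f).stalkMap η = (schemeHom g).stalkMap η := by
    ext b
    exact he b
  have hθ' : Spec.map ((schemeHom f).stalkMap η) ≫ Spec.map θ = Spec.map ((schemeHom g).stalkMap η)
      := by rw [← hθ, Spec.map_comp]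
  obtain ⟨ρ, hρ⟩ := exists_hom_of_stalk (apply_genericPoint f)
    (Spec.map θ ≫ F.scheme.fromSpecStalk (schemeHom g η)) (by
      have : IsDominant (Spec.map ((schemeHom f).stalkMap η)) := by
        refine ⟨(PrimeSpectrum.denseRange_comap_iff_ker_le_nilRadical _).2 ?_⟩
        exact ((RingHom.injective_iff_ker_eq_bot _).1 (functionFieldMap_injective f)).trans_le
          bot_le
      -- Compatibility with `K` is checked after pulling back to the generic point of `C`, where
      -- both sides become its structure map.
      refine ext_of_isDominant (Spec.map ((schemeHom f).stalkMap η)) ?_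
      rw [Category.assoc, reassoc_of% hθ', Scheme.SpecMap_stalkMap_fromSpecStalk_assoc,
        Scheme.SpecMap_stalkMap_fromSpecStalk_assoc]
      congr 1
      exact (Over.w g.hom).trans (Over.w f.hom).symm)
  refine ⟨ρ, ?_⟩
  ext1
  ext1
  refine ext_of_isDominant (C.scheme.fromSpecStalk η) ?_
  change _ ≫ schemeHom f ≫ schemeHom ρ = _ ≫ schemeHom g
  rw [← Scheme.SpecMap_stalkMap_fromSpecStalk_assoc, hρ, reassoc_of% hθ',
    Scheme.SpecMap_stalkMap_fromSpecStalk]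

lemma exists_iso_of_range_eq {C E F : Curve K} (f : C ⟶ E) (g : C ⟶ F)
    [IsDominant (schemeHom f)] [IsDominant (schemeHom g)]
    (h : (functionFieldMap f).range = (functionFieldMap g).range) :
    ∃ ρ : E ≅ F, f ≫ ρ.hom = g := by
  obtain ⟨ρ, hρ⟩ := exists_hom_of_range_eq f g h
  obtain ⟨σ, hσ⟩ := exists_hom_of_range_eq g f h.symm
  exact ⟨⟨ρ, σ, cancel_dominant f (by rw [reassoc_of% hρ, hσ, Category.comp_id]),
    cancel_dominant g (by rw [reassoc_of% hσ, hρ, Category.comp_id])⟩, hρ⟩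

/-! ### Chains of subfields attached to decompositions. -/

/-- The subring of `K(C)` of the functions pulled back along a morphism from `C`. -/
def pullbackRange {C D : Curve K} (φ : C ⟶ D) :
    Subring (C.scheme.presheaf.stalk (genericPoint C.scheme)) :=
  (functionFieldMap φ).range

lemma pullbackRange_comp {C D E : Curve K} (φ : C ⟶ D) (ψ : D ⟶ E) :
    pullbackRange (φ ≫ ψ) =
      ((schemeHom ψ).stalkMap (schemeHom φ (genericPoint C.scheme))).hom.range.map
        (functionFieldMap φ) := by
  have h := congrArg (fun f => f.hom.range)
    (Scheme.Hom.stalkMap_comp (schemeHom φ) (schemeHom ψ) (genericPoint C.scheme))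
  refine h.trans ?_
  rw [functionFieldMap, RingHom.map_range]
  rfl

lemma pullbackRange_comp_le {C D E : Curve K} (φ : C ⟶ D) (ψ : D ⟶ E) :
    pullbackRange (φ ≫ ψ) ≤ pullbackRange φ := by
  rw [pullbackRange_comp]
  rintro _ ⟨x, -, rfl⟩
  exact ⟨x, rfl⟩

lemma pullbackRange_comp_lt {C D E : Curve K} (φ : C ⟶ D) (ψ : D ⟶ E)
    [IsDominant (schemeHom φ)] (hψ : 2 ≤ degree ψ) :
    pullbackRange (φ ≫ ψ) < pullbackRange φ := by
  refine lt_of_le_of_ne (pullbackRange_comp_le φ ψ) fun h => ?_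
  have hsurj (x : D.scheme) (hx : x = schemeHom φ (genericPoint C.scheme)) :
      Function.Surjective ((schemeHom ψ).stalkMap x).hom := by
    subst hx
    rw [pullbackRange_comp, pullbackRange] at h
    intro a
    obtain ⟨_, ⟨b, rfl⟩, hb⟩ := h.ge ⟨a, rfl⟩
    exact ⟨b, functionFieldMap_injective φ hb⟩
  have h1 : degree ψ ≤ 1 := by
    let := (functionFieldMap ψ).toAlgebra
    refine finrank_le_one 1 fun w => ?_
    obtain ⟨c, hc⟩ := hsurj _ (apply_genericPoint φ).symm w
    refine ⟨c, ?_⟩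
    rw [Algebra.smul_def, mul_one]
    exact hc
  omega

/-- The pullback ranges of the composites of the initial segments of a path. -/
def pathRanges {C : Curve K} : ∀ {D : Curve K}, Quiver.Path C D →
    List (Subring (C.scheme.presheaf.stalk (genericPoint C.scheme)))
  | _, .nil => [pullbackRange (𝟙 C)]
  | _, .cons p φ => pullbackRange (composePath p ≫ φ) :: pathRanges p

lemma exists_pathRanges_eq_cons {C D : Curve K} (p : Quiver.Path C D) :
    ∃ l, pathRanges p = pullbackRange (composePath p) :: l := by
  cases p with
  | nil => exact ⟨[], rfl⟩
  | cons p φ => exact ⟨pathRanges p, rfl⟩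

lemma AllCovers.isDominant {C D : Curve K} {p : Quiver.Path C D} (hp : AllCovers p) :
    IsDominant (schemeHom (composePath p)) := by
  induction p with
  | nil => exact inferInstanceAs (IsDominant (𝟙 C.scheme))
  | cons p φ ih =>
    have := ih hp.1
    have := isDominant_schemeHom hp.2.1.nonconstant
    rw [composePath_cons]
    infer_instance

lemma AllCovers.isChain_pathRanges {C D : Curve K} {p : Quiver.Path C D} (hp : AllCovers p) :
    (pathRanges p).IsChain (· < ·) := by
  induction p with
  | nil => exact List.isChain_singleton _
  | cons p φ ih =>
    have := hp.1.isDominant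
    obtain ⟨l, hl⟩ := exists_pathRanges_eq_cons p
    have h := ih hp.1
    rw [pathRanges, hl]
    rw [hl] at h
    exact List.isChain_cons_cons.2 ⟨pullbackRange_comp_lt _ _ hp.2.2, h⟩

lemma pullbackRange_le_of_mem_pathRanges {C D : Curve K} {p : Quiver.Path C D} :
    ∀ S ∈ pathRanges p, pullbackRange (composePath p) ≤ S := by
  induction p with
  | nil =>
    intro S hS
    rw [List.mem_singleton.1 hS]
    rfl
  | cons p φ ih =>
    intro S hS
    rw [composePath_cons]
    obtain rfl | hS := List.mem_cons.1 hS
    · rfl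
    · exact (pullbackRange_comp_le _ _).trans (ih S hS)

lemma exists_pathIso_of_pathRanges_eq {C D E : Curve K} {p : Quiver.Path C D}
    {q : Quiver.Path C E} (hp : AllCovers p) (hq : AllCovers q)
    (h : pathRanges p = pathRanges q) :
    ∃ ρ : D ≅ E, PathIso p q ρ ∧ composePath p ≫ ρ.hom = composePath q := by
  induction p generalizing E with
  | nil =>
    cases q with
    | nil => exact ⟨Iso.refl C, .nil, by simp⟩
    | cons q ψ =>
      obtain ⟨l, hl⟩ := exists_pathRanges_eq_cons q
      simp [pathRanges, hl] at h
  | cons p φ ih =>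
    cases q with
    | nil =>
      obtain ⟨l, hl⟩ := exists_pathRanges_eq_cons p
      simp [pathRanges, hl] at h
    | cons q ψ =>
      obtain ⟨h1, h2⟩ := List.cons.inj h
      obtain ⟨ρ, hρ, hρ'⟩ := ih hp.1 hq.1 h2
      have := hp.isDominant
      have := hq.isDominant
      have := hp.1.isDominant
      -- The new square commutes because it does so after precomposition with the dominant
      -- `composePath p`.
      obtain ⟨σ, hσ⟩ := exists_iso_of_range_eq (composePath (p.cons φ)) (composePath (q.cons ψ))
        h1
      refine ⟨σ, .cons hρ φ ψ σ (cancel_dominant (composePath p) ?_), hσ⟩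
      rw [reassoc_of% hρ', ← composePath_cons, ← hσ, composePath_cons, Category.assoc]

lemma Decomposition.equiv_of_pathRanges_eq {C D : Curve K} {φ : C ⟶ D} (p q : Decomposition φ)
    (h : pathRanges p.path = pathRanges q.path) : Decomposition.setoid φ p q := by
  obtain ⟨ρ, hρ, hρ'⟩ := exists_pathIso_of_pathRanges_eq p.allCovers q.allCovers h
  have := p.allCovers.isDominant
  have : ρ = Iso.refl D := by
    ext1
    refine cancel_dominant (composePath p.path) ?_
    rw [hρ', p.composition, q.composition, Iso.refl_hom, Category.comp_id]
  subst this
  exact hρ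

/-- Together with algebraicity, this makes the function field extension finite, as the Galois
argument requires. -/
lemma essFiniteType_functionFieldMap {C D : Curve K} (φ : C ⟶ D) :
    (functionFieldMap φ).EssFiniteType := by
  have : LocallyOfFiniteType (schemeHom φ ≫ D.obj.hom) := by
    rw [Over.w φ.hom]
    infer_instance
  have : LocallyOfFiniteType (schemeHom φ) := locallyOfFiniteType_of_comp _ D.obj.hom
  exact LocallyOfFiniteType.stalkMap _ _

end Curve

end

theorem corollary2p3 (K : Type u) [Field K] (C D : Curve K) (φ : C ⟶ D) (hφ : Curve.IsCover φ) :
    Finite (Curve.DecompositionClass φ) ∧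
      Nat.card (Curve.DecompositionClass φ) ≤ decreasingChainCount (Curve.degree φ) := by
  have := Curve.isDominant_schemeHom hφ.nonconstant
  have hfin := Curve.essFiniteType_functionFieldMap φ
  have hsep := hφ.separable
  let := (Curve.isField_stalk_of_isDominant φ).toField
  let : Field (C.scheme.presheaf.stalk (genericPoint C.scheme)) :=
    inferInstanceAs (Field C.scheme.functionField)
  let := (Curve.functionFieldMap φ).toAlgebra
  have : Algebra.EssFiniteType (D.scheme.presheaf.stalk (Curve.schemeHom φ
    (genericPoint C.scheme))) (C.scheme.presheaf.stalk (genericPoint C.scheme)) := hfin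
  have : Algebra.IsSeparable (D.scheme.presheaf.stalk (Curve.schemeHom φ
    (genericPoint C.scheme))) (C.scheme.presheaf.stalk (genericPoint C.scheme)) := hsep
  have : FiniteDimensional (D.scheme.presheaf.stalk (Curve.schemeHom φ
    (genericPoint C.scheme))) (C.scheme.presheaf.stalk (genericPoint C.scheme)) :=
    Algebra.finite_of_essFiniteType_of_isAlgebraic
  refine finite_and_card_le_of_injective_chains
    (F := D.scheme.presheaf.stalk (Curve.schemeHom φ (genericPoint C.scheme)))
    (E := C.scheme.presheaf.stalk (genericPoint C.scheme))
    (fun c : Curve.DecompositionClass φ => Curve.pathRanges c.out.path)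
    (fun c d h => ?_) (fun c h => ?_) (fun c => c.out.allCovers.isChain_pathRanges)
    (fun c S hS => ?_)
  · rw [← c.out_eq, ← d.out_eq]
    exact Quotient.sound (Curve.Decomposition.equiv_of_pathRanges_eq _ _ h)
  · obtain ⟨l, hl⟩ := Curve.exists_pathRanges_eq_cons c.out.path
    exact List.cons_ne_nil _ _ (hl.symm.trans h)
  · have h := Curve.pullbackRange_le_of_mem_pathRanges S hS
    rw [c.out.composition] at h
    exact h
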